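/- Let $K\ge 1$, $[K]=\{1,\dots,K\}$, and consider the $K$-user complex channel $Y_r(t)=\sum_{j=1}^{K}h_{rj}(t)X_j(t)+Z_r(t)$, $r\in[K]$, with deterministic coefficients known everywhere (for instance constant in $t$) such that $h_{rj}(t)\neq 0$ if and only if $r\in\{j,j+1\}$ (transmitter $j$ is then said to be connected to receiver $r$), where for each $r$ the noises $Z_r(t)$ are i.i.d. over $t$, circularly symmetric complex Gaussian with mean zero and variance one. The messages $W_1,\dots,W_K$ are independent and uniform on finite sets. Let $\mathcal T_1,\dots,\mathcal T_K\subseteq[K]$ be transmit sets. A code of block length $n$ consists of deterministic encoders, the codeword of transmitter $j$ being a function of the messages $W_i$ with $j\in\mathcal T_i$, and of measurable decoders, receiver $r$ estimating $W_r$ from $Y_r(1),\dots,Y_r(n)$. Its rates are $\frac{\log|W_i|}{n}$. The total power constraint is $\frac1n\sum_{t=1}^{n}\sum_{j=1}^{K}\mathbb E|X_j(t)|^2\le P$, where $P\ge0$. A tuple $(R_1,\dots,R_K)$ of non-negative reals is achievable if for every $\varepsilon>0$ and all sufficiently large $n$ there is a code of block length $n$ satisfying the power constraint, with rate at least $R_i-\varepsilon$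 and error probability at most $\varepsilon$ for every message $W_i$. The sum capacity $C_\Sigma(P)$ is the supremum of $\sum_i R_i$ over all achievable tuples. For a message $W_i$, let $G_{W_i,\mathcal T_i}$ be the graph with vertex set $[K]$ in which two distinct vertices $x,y$ are adjacent if and only if $x,y\in\mathcal T_i$ and some receiver is connected to both transmitters $x$ and $y$ (in this channel: $|x-y|=1$). A vertex is marked if the transmitter with that label is connected to receiver $i$, that is, if it is $i$ or $i-1$. Let $k\in\mathcal T_i$ be such that the connected component of $k$ in $G_{W_i,\mathcal T_i}$ contains no marked vertex. Then replacing $\mathcal T_i$ by $\mathcal T_i\setminus\{k\}$, and leaving the other transmit sets unchanged, does not decrease the sum rate: for every tuple $(R_j)$ achievable for the original transmit sets with power $P$, there is a tuple $(R_j')$ achievable for the new transmit sets with power $P$ such that $\sum_j R_j\le\sum_j R_j'$; in particular the sum capacity $C_\Sigma(P)$ for the new transmit sets is at least that for the original ones. -/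

import Mathlib

open MeasureTheory ProbabilityTheory

namespace WynerIC

/-- Connectivity of Wyner's linear asymmetric model with `K` users: transmitter `j` is connected to
receiver `r` exactly when `r ∈ {j, j + 1}` (users are labelled `0, …, K - 1`). -/
def IsConn {K : ℕ} (r j : Fin K) : Prop :=
  (r : ℕ) = (j : ℕ) ∨ (r : ℕ) = (j : ℕ) + 1

/-- The channel coefficients `h t r j` (time `t`, from transmitter `j` to receiver `r`) have the
connectivity of Wyner's asymmetric model. A coefficient that is constant in time is the special
case in which `h` does not depend on `t`. -/
def IsWynerChannel {K : ℕ} (h : ℕ → Fin K → Fin K → ℂ) : Prop :=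
  ∀ (t : ℕ) (r j : Fin K), h t r j ≠ 0 ↔ IsConn r j

/-- The graph attached to a transmit set `S`: the vertices are all transmitters, and two distinct
transmitters are adjacent when both belong to `S` and some receiver is connected to both. -/
def messageGraph {K : ℕ} (S : Finset (Fin K)) : SimpleGraph (Fin K) where
  Adj x y := x ≠ y ∧ x ∈ S ∧ y ∈ S ∧ ∃ r : Fin K, IsConn r x ∧ IsConn r y
  symm := ⟨fun _ _ h => ⟨h.1.symm, h.2.2.1, h.2.1, h.2.2.2.imp fun _ hr => ⟨hr.2, hr.1⟩⟩⟩
  loopless := ⟨fun _ h => h.1 rfl⟩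

/-- In Wyner's asymmetric model adjacency means that the two indices differ by one. -/
theorem messageGraph_adj_iff {K : ℕ} (S : Finset (Fin K)) (x y : Fin K) :
    (messageGraph S).Adj x y ↔
      x ∈ S ∧ y ∈ S ∧ ((x : ℕ) = (y : ℕ) + 1 ∨ (y : ℕ) = (x : ℕ) + 1) := by
  constructor
  · rintro ⟨hne, hx, hy, r, hrx, hry⟩
    have hne' : (x : ℕ) ≠ y := fun h => hne (Fin.ext h)
    refine ⟨hx, hy, ?_⟩
    unfold IsConn at hrx hry
    omega
  · rintro ⟨hx, hy, h⟩
    refine ⟨fun e => by subst e; omega, hx, hy, ?_⟩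
    rcases h with h | h
    · exact ⟨x, Or.inl rfl, Or.inr h⟩
    · exact ⟨y, Or.inr h, Or.inl rfl⟩

/-- A vertex is marked for message `i` when the transmitter is connected to receiver `i`. -/
def IsMarked {K : ℕ} (i k : Fin K) : Prop := IsConn i k

/-- The circularly symmetric complex Gaussian law with mean zero and variance one: the real and the
imaginary part are independent real Gaussians of variance `1 / 2`. -/
noncomputable def noiseLaw : Measure ℂ :=
  ((gaussianReal 0 (1 / 2)).prod (gaussianReal 0 (1 / 2))).map (fun p : ℝ × ℝ => ⟨p.1, p.2⟩)

theorem isProbabilityMeasure_noiseLaw : IsProbabilityMeasure noiseLaw :=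
  Measure.isProbabilityMeasure_map Complex.measurableEquivRealProd.symm.measurable.aemeasurable

/-- The law of the noise seen by one receiver during `n` channel uses (independent over time). -/
noncomputable def noiseLawBlock (n : ℕ) : Measure (Fin n → ℂ) :=
  Measure.pi (fun _ => noiseLaw)

/-- A block code of length `n` for the transmit sets `T`. Message `i` takes `size i` values; the
codeword of transmitter `j` depends only on the messages available at `j`, that is, on those `i`
with `j ∈ T i`; receiver `i` decodes message `i` from its own received block. -/
structure Code {K : ℕ} (T : Fin K → Finset (Fin K)) (n : ℕ) where
  size : Fin K → ℕ
  size_pos : ∀ i, 0 < size i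
  enc : Fin K → (∀ i, Fin (size i)) → Fin n → ℂ
  enc_congr : ∀ (j : Fin K) (w w' : ∀ i, Fin (size i)),
    (∀ i, j ∈ T i → w i = w' i) → enc j w = enc j w'
  dec : ∀ i, (Fin n → ℂ) → Fin (size i)
  measurable_dec : ∀ i, Measurable (dec i)

namespace Code

variable {K n : ℕ} {T : Fin K → Finset (Fin K)}

/-- The block received at receiver `r` when the message tuple is `w` and the noise there is `z`. -/
noncomputable def received (c : Code T n) (h : ℕ → Fin K → Fin K → ℂ) (r : Fin K)
    (w : ∀ i, Fin (c.size i)) (z : Fin n → ℂ) : Fin n → ℂ :=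
  fun t => ∑ j, h t r j * c.enc j w t + z t

/-- The expectation of a function of the messages, which are independent and uniform. -/
noncomputable def mean (c : Code T n) (f : (∀ i, Fin (c.size i)) → ℝ) : ℝ :=
  (∑ w, f w) / ∏ i, (c.size i : ℝ)

/-- The expected total energy spent by all transmitters over the block. -/
noncomputable def energy (c : Code T n) : ℝ :=
  c.mean fun w => ∑ j, ∑ t, ‖c.enc j w t‖ ^ 2

/-- The probability that receiver `i` decodes message `i` wrongly. -/
noncomputable def errorProb (c : Code T n) (h : ℕ → Fin K → Fin K → ℂ) (i : Fin K) : ℝ :=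
  c.mean fun w => (noiseLawBlock n).real {z | c.dec i (c.received h i w z) ≠ w i}

/-- The rate of message `i`, in nats per channel use. -/
noncomputable def rate (c : Code T n) (i : Fin K) : ℝ :=
  Real.log (c.size i) / n

end Code

/-- The capacity region under total average power `P`: the set of achievable rate tuples. A tuple
`R` is achievable when, for every `ε > 0` and all large block lengths, some code that respects the
power constraint has rates at least `R i - ε` and all error probabilities at most `ε`. -/
def capacityRegion {K : ℕ} (h : ℕ → Fin K → Fin K → ℂ) (T : Fin K → Finset (Fin K)) (P : ℝ) :
    Set (Fin K → ℝ) :=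
  {R | (∀ i, 0 ≤ R i) ∧ ∀ ε : ℝ, 0 < ε → ∃ N : ℕ, ∀ n : ℕ, N ≤ n → ∃ c : Code T n,
    c.energy ≤ n * P ∧ ∀ i, R i - ε ≤ c.rate i ∧ c.errorProb h i ≤ ε}

/-- The sum capacity: the supremum of the achievable sum rates, in the extended reals. -/
noncomputable def sumCapacity {K : ℕ} (h : ℕ → Fin K → Fin K → ℂ) (T : Fin K → Finset (Fin K))
    (P : ℝ) : EReal :=
  ⨆ R ∈ capacityRegion h T P, ((∑ i, R i : ℝ) : EReal)

/-- The transmit sets after transmitter `k` has been removed from the transmit set of message `i`;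
all the other transmit sets are unchanged. -/
def removeTransmitter {K : ℕ} (T : Fin K → Finset (Fin K)) (i k : Fin K) :
    Fin K → Finset (Fin K) :=
  Function.update T i ((T i).erase k)

end WynerIC

namespace WynerIC

/-! Let `S` be the component of `k`, and let the transmitters in `S` use a constant `x` in place of
message `i`. A receiver that hears nothing from `S` notices no change. Any other receiver is not
`i`, and every transmitter it hears that knows message `i` lies in `S`; so it sees the original code
with message `i` overwritten by `x`. As message `i` is uniform, averaging over `x` preserves the
energy and all error probabilities (`sum_energy_freeze`, `sum_errorProb_freeze`). One `x` must serve
all these quantities, so `exists_freeze_le` averages a weighted sum of them. This costs an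
arbitrarily small excess power, which `mem_capacityRegion_of_excess_power` removes by keeping silent
for a small fraction of the block. At `P = 0` all energies vanish and no excess arises. Hence the
same rate tuple stays achievable. -/

/-- Precomposing a function of a finite dependent product with `Function.update · i x` and summing
over `x` and over the product counts every point as often as the `i`-th factor has elements. -/
theorem sum_sum_update {ι : Type*} [Fintype ι] [DecidableEq ι] {α : ι → Type*}
    [∀ i, Fintype (α i)] (i : ι) (f : (∀ i, α i) → ℝ) :
    ∑ x : α i, ∑ w, f (Function.update w i x) = Fintype.card (α i) * ∑ w, f w := by
  -- Swapping `x` with the `i`-th coordinate of `w` permutes the pairs `(x, w)`.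
  have hinv : Function.Involutive
      (fun p : α i × (∀ i, α i) => (p.2 i, Function.update p.2 i p.1)) := by
    rintro ⟨x, w⟩
    simp
  calc ∑ x : α i, ∑ w, f (Function.update w i x)
      = ∑ p : α i × (∀ i, α i), f (hinv.toPerm _ p).2 := by
        rw [Fintype.sum_prod_type]; rfl
    _ = ∑ p : α i × (∀ i, α i), f p.2 :=
        Equiv.sum_comp (hinv.toPerm _) (fun p : α i × (∀ i, α i) => f p.2)
    _ = Fintype.card (α i) * ∑ w, f w := by
        rw [Fintype.sum_prod_type]; simp

/-- The first `m` coordinates of an i.i.d. block of noise form an i.i.d. block of noise. -/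
theorem measurePreserving_noiseLawBlock (m l : ℕ) :
    MeasurePreserving (fun (z : Fin (m + l) → ℂ) (t : Fin m) => z (Fin.castAdd l t))
      (noiseLawBlock (m + l)) (noiseLawBlock m) := by
  have := isProbabilityMeasure_noiseLaw
  have hmeas : Measurable (fun (z : Fin (m + l) → ℂ) (t : Fin m) => z (Fin.castAdd l t)) := by
    fun_prop
  refine ⟨hmeas, (Measure.pi_eq fun s hs => ?_).symm⟩
  rw [Measure.map_apply hmeas (MeasurableSet.univ_pi hs)]
  have hpre : (fun (z : Fin (m + l) → ℂ) (t : Fin m) => z (Fin.castAdd l t)) ⁻¹' Set.univ.pi s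
      = Set.univ.pi (Fin.append s fun _ => Set.univ) := by
    ext z
    simp only [Set.mem_preimage, Set.mem_univ_pi]
    refine ⟨fun H t => ?_, fun H t => by simpa using H (Fin.castAdd l t)⟩
    refine Fin.addCases (fun t => ?_) (fun t => ?_) t
    · simpa using H t
    · simp
  rw [hpre, noiseLawBlock, Measure.pi_pi, Fin.prod_univ_add]
  simp

namespace Code

variable {K n : ℕ} {T T' : Fin K → Finset (Fin K)}

theorem mean_nonneg (c : Code T n) {f : (∀ i, Fin (c.size i)) → ℝ} (hf : ∀ w, 0 ≤ f w) :
    0 ≤ c.mean f :=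
  div_nonneg (Finset.sum_nonneg fun w _ => hf w) (by positivity)

theorem mean_sum {ι : Type*} (c : Code T n) (s : Finset ι)
    (f : ι → (∀ i, Fin (c.size i)) → ℝ) :
    c.mean (fun w => ∑ a ∈ s, f a w) = ∑ a ∈ s, c.mean (f a) := by
  simp only [mean]
  rw [Finset.sum_comm, Finset.sum_div]

/-- Overwriting a uniform message by an independent uniform value leaves the law of the tuple
unchanged. -/
theorem sum_mean_update (c : Code T n) (i : Fin K) (f : (∀ i, Fin (c.size i)) → ℝ) :
    ∑ x : Fin (c.size i), c.mean (fun w => f (Function.update w i x)) = c.size i * c.mean f := by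
  simp only [mean]
  rw [← Finset.sum_div, sum_sum_update (α := fun i => Fin (c.size i)) i f]
  simp [mul_div_assoc]

theorem sum_mean_const (c : Code T n) (i : Fin K) (f : (∀ i, Fin (c.size i)) → ℝ) :
    ∑ _x : Fin (c.size i), c.mean f = c.size i * c.mean f := by
  simp

theorem energy_nonneg (c : Code T n) : 0 ≤ c.energy :=
  c.mean_nonneg fun _ => by positivity

theorem errorProb_nonneg (c : Code T n) (h : ℕ → Fin K → Fin K → ℂ) (i : Fin K) :
    0 ≤ c.errorProb h i :=
  c.mean_nonneg fun _ => measureReal_nonneg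

/-! ### Freezing a message on a set of transmitters -/

open Classical in
/-- The code in which the transmitters in `S` use the fixed value `x` in place of message `i`. -/
noncomputable def freeze (c : Code T n) (i : Fin K) (S : Set (Fin K))
    (hT : ∀ j l, j ∈ T l → j ∈ T' l ∨ l = i ∧ j ∈ S) (x : Fin (c.size i)) : Code T' n where
  size := c.size
  size_pos := c.size_pos
  enc j w := if j ∈ S then c.enc j (Function.update w i x) else c.enc j w
  enc_congr j w w' hw := by
    split_ifs with hj
    · refine c.enc_congr _ _ _ fun l hl => ?_
      by_cases hli : l = i
      · subst hli; simp
      · rw [Function.update_of_ne hli, Function.update_of_ne hli]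
        exact hw l ((hT j l hl).resolve_right fun H => hli H.1)
    · exact c.enc_congr _ _ _ fun l hl => hw l ((hT j l hl).resolve_right fun H => hj H.2)
  dec := c.dec
  measurable_dec := c.measurable_dec

section freeze

variable (c : Code T n) (i : Fin K) (S : Set (Fin K))
  (hT : ∀ j l, j ∈ T l → j ∈ T' l ∨ l = i ∧ j ∈ S)

theorem freeze_enc_of_mem {j : Fin K} (hj : j ∈ S) (x : Fin (c.size i))
    (w : ∀ i, Fin (c.size i)) :
    (c.freeze i S hT x).enc j w = c.enc j (Function.update w i x) :=
  if_pos hj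

theorem freeze_enc_of_notMem {j : Fin K} (hj : j ∉ S) (x : Fin (c.size i))
    (w : ∀ i, Fin (c.size i)) :
    (c.freeze i S hT x).enc j w = c.enc j w :=
  if_neg hj

/-- Averaged over the frozen value, the energy does not change. -/
theorem sum_energy_freeze :
    ∑ x, (c.freeze i S hT x).energy = c.size i * c.energy := by
  have key : ∀ j : Fin K,
      ∑ x : Fin (c.size i), c.mean (fun w => ∑ t, ‖(c.freeze i S hT x).enc j w t‖ ^ 2)
        = c.size i * c.mean (fun w => ∑ t, ‖c.enc j w t‖ ^ 2) := by
    intro j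
    by_cases hj : j ∈ S
    · rw [← c.sum_mean_update i]
      exact Finset.sum_congr rfl fun x _ => by
        congr 1; funext w; rw [freeze_enc_of_mem c i S hT hj]
    · rw [← c.sum_mean_const i]
      exact Finset.sum_congr rfl fun x _ => by
        congr 1; funext w; rw [freeze_enc_of_notMem c i S hT hj]
  calc ∑ x, (c.freeze i S hT x).energy
      = ∑ x, ∑ j, c.mean (fun w => ∑ t, ‖(c.freeze i S hT x).enc j w t‖ ^ 2) :=
        Finset.sum_congr rfl fun x _ =>
          c.mean_sum Finset.univ fun j w => ∑ t, ‖(c.freeze i S hT x).enc j w t‖ ^ 2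
    _ = ∑ j, c.size i * c.mean (fun w => ∑ t, ‖c.enc j w t‖ ^ 2) := by
        rw [Finset.sum_comm]; exact Finset.sum_congr rfl fun j _ => key j
    _ = c.size i * c.energy := by
        rw [← Finset.mul_sum, energy, mean_sum]

/-- If a receiver hears only transmitters outside `S`, or is not receiver `i` and hears only
transmitters that are in `S` or do not know message `i`, then its error probability, averaged over
the frozen value, does not change. -/
theorem sum_errorProb_freeze (h : ℕ → Fin K → Fin K → ℂ) (r : Fin K)
    (hr : (∀ t j, h t r j ≠ 0 → j ∉ S) ∨
      r ≠ i ∧ ∀ t j, h t r j ≠ 0 → j ∈ S ∨ j ∉ T i) :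
    ∑ x, (c.freeze i S hT x).errorProb h r = c.size i * c.errorProb h r := by
  rcases hr with hr | ⟨hri, hr⟩
  · have hrec : ∀ x (w : ∀ i, Fin (c.size i)) z, (c.freeze i S hT x).received h r w z = c.received h r w z := by
      intro x w z
      funext t
      simp only [received]
      congr 1
      refine Finset.sum_congr rfl fun j _ => ?_
      by_cases h0 : h t r j = 0
      · simp [h0]
      · exact congrArg (fun y : Fin n → ℂ => h t r j * y t)
          (freeze_enc_of_notMem c i S hT (hr t j h0) x w)
    rw [errorProb, ← c.sum_mean_const i]
    refine Finset.sum_congr rfl fun x _ => ?_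
    exact congrArg c.mean (funext fun w =>
      congrArg (fun y : (Fin n → ℂ) → Fin n → ℂ => (noiseLawBlock n).real {z | c.dec r (y z) ≠ w r})
        (funext (hrec x w)))
  · have hrec : ∀ x (w : ∀ i, Fin (c.size i)) z, (c.freeze i S hT x).received h r w z
        = c.received h r (Function.update w i x) z := by
      intro x w z
      funext t
      simp only [received]
      congr 1
      refine Finset.sum_congr rfl fun j _ => ?_
      by_cases h0 : h t r j = 0
      · simp [h0]
      by_cases hj : j ∈ S
      · exact congrArg (fun y : Fin n → ℂ => h t r j * y t) (freeze_enc_of_mem c i S hT hj x w)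
      · refine congrArg (fun y : Fin n → ℂ => h t r j * y t)
          ((freeze_enc_of_notMem c i S hT hj x w).trans ?_)
        refine c.enc_congr _ _ _ fun l hl => ?_
        have hli : l ≠ i := by
          rintro rfl
          exact (hr t j h0).elim hj fun H => H hl
        rw [Function.update_of_ne hli]
    rw [errorProb, ← c.sum_mean_update i]
    refine Finset.sum_congr rfl fun x _ => ?_
    -- Since `r ≠ i`, the message to be decoded survives the overwriting, so the error event is the
    -- original one at the updated tuple.
    simp only [Function.update_of_ne hri]
    exact congrArg c.mean (funext fun w =>
      congrArg (fun y : (Fin n → ℂ) → Fin n → ℂ => (noiseLawBlock n).real {z | c.dec r (y z) ≠ w r})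
        (funext (hrec x w)))

end freeze

/-- Some frozen value does no worse than the original code for a weighted sum of the energy and the
error probabilities, and multiplies the energy at most by the number of values of the message. -/
theorem exists_freeze_le (c : Code T n) (i : Fin K) (S : Set (Fin K))
    (hT : ∀ j l, j ∈ T l → j ∈ T' l ∨ l = i ∧ j ∈ S) (h : ℕ → Fin K → Fin K → ℂ)
    (hS : ∀ r, (∀ t j, h t r j ≠ 0 → j ∉ S) ∨
      r ≠ i ∧ ∀ t j, h t r j ≠ 0 → j ∈ S ∨ j ∉ T i) (a : ℝ) :
    ∃ c' : Code T' n, (∀ r, c'.rate r = c.rate r) ∧ c'.energy ≤ c.size i * c.energy ∧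
      c'.energy + a * ∑ r, c'.errorProb h r ≤ c.energy + a * ∑ r, c.errorProb h r := by
  have hpos := c.size_pos i
  have : Nonempty (Fin (c.size i)) := ⟨⟨0, hpos⟩⟩
  have hsum : ∑ x, ((c.freeze i S hT x).energy + a * ∑ r, (c.freeze i S hT x).errorProb h r)
      = ∑ _x : Fin (c.size i), (c.energy + a * ∑ r, c.errorProb h r) := by
    rw [Finset.sum_add_distrib, sum_energy_freeze, ← Finset.mul_sum, Finset.sum_comm,
      Finset.sum_congr rfl fun r _ => sum_errorProb_freeze c i S hT h r (hS r),
      ← Finset.mul_sum, Finset.sum_const, Finset.card_univ, Fintype.card_fin, nsmul_eq_mul]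
    ring
  obtain ⟨x, -, hx⟩ := Finset.exists_le_of_sum_le Finset.univ_nonempty hsum.le
  refine ⟨c.freeze i S hT x, fun r => rfl, ?_, hx⟩
  -- A crude bound, one nonnegative term against the whole sum; it is needed only when the energy is
  -- zero.
  rw [← sum_energy_freeze c i S hT]
  exact Finset.single_le_sum (f := fun x => (c.freeze i S hT x).energy)
    (fun x _ => energy_nonneg _) (Finset.mem_univ x)

/-! ### Padding with silence and trading excess power for rate -/

/-- The code that is silent during `l` further channel uses, which the decoders ignore. -/
noncomputable def padSilence {m : ℕ} (c : Code T m) (l : ℕ) : Code T (m + l) where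
  size := c.size
  size_pos := c.size_pos
  enc j w := Fin.append (c.enc j w) fun _ => 0
  enc_congr j w w' hw := by rw [c.enc_congr j w w' hw]
  dec i y := c.dec i fun t => y (Fin.castAdd l t)
  measurable_dec i := (c.measurable_dec i).comp (by fun_prop)

theorem energy_padSilence {m : ℕ} (c : Code T m) (l : ℕ) :
    (c.padSilence l).energy = c.energy := by
  change c.mean (fun w => ∑ j, ∑ t, ‖Fin.append (c.enc j w) (fun _ : Fin l => 0) t‖ ^ 2) = _
  simp [energy, Fin.sum_univ_add]

/-- The silence comes last, so the first `m` outputs meet the same coefficients, even when `h`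
varies in time, and their noise is the marginal of the longer block. -/
theorem errorProb_padSilence {m : ℕ} (c : Code T m) (l : ℕ) (h : ℕ → Fin K → Fin K → ℂ)
    (i : Fin K) : (c.padSilence l).errorProb h i = c.errorProb h i := by
  change c.mean (fun w => (noiseLawBlock (m + l)).real
    {z | c.dec i (fun t => (c.padSilence l).received h i w z (Fin.castAdd l t)) ≠ w i}) = _
  rw [errorProb]
  congr 1
  funext w
  have hmeas : MeasurableSet {z | c.dec i (c.received h i w z) ≠ w i} := by
    have hrec : Measurable (c.received h i w) := by
      unfold received
      fun_prop
    exact ((c.measurable_dec i).comp hrec) (MeasurableSet.of_discrete (s := {w i}ᶜ))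
  rw [← (measurePreserving_noiseLawBlock m l).measureReal_preimage hmeas.nullMeasurableSet]
  congr 1
  ext z
  have hrec : (fun t => (c.padSilence l).received h i w z (Fin.castAdd l t))
      = c.received h i w fun t => z (Fin.castAdd l t) := by
    funext t
    simp [received, padSilence]
  exact iff_of_eq (congrArg (fun y => c.dec i y ≠ w i) hrec)

theorem exists_extension {m : ℕ} (c : Code T m) (hmn : m ≤ n) (h : ℕ → Fin K → Fin K → ℂ) :
    ∃ c' : Code T n, c'.size = c.size ∧ c'.energy = c.energy ∧
      ∀ i, c'.errorProb h i = c.errorProb h i := by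
  obtain ⟨l, rfl⟩ := Nat.exists_eq_add_of_le hmn
  exact ⟨c.padSilence l, rfl, c.energy_padSilence l, c.errorProb_padSilence l h⟩

end Code

/-- The capacity region at power `P` contains every rate tuple that is achievable at powers
above and arbitrarily close to `P`, as long as `P` is positive. -/
theorem mem_capacityRegion_of_excess_power {K : ℕ} {h : ℕ → Fin K → Fin K → ℂ}
    {T : Fin K → Finset (Fin K)} {P : ℝ} (hP : 0 < P) {R : Fin K → ℝ}
    (hR : ∀ δ : ℝ, 0 < δ → R ∈ capacityRegion h T (P + δ)) : R ∈ capacityRegion h T P := by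
  have hR0 := (hR 1 one_pos).1
  refine ⟨hR0, fun ε hε => ?_⟩
  set M : ℝ := ∑ i, R i with hM
  have hM0 : 0 ≤ M := Finset.sum_nonneg fun i _ => hR0 i
  have hRM : ∀ i, R i ≤ M := fun i =>
    Finset.single_le_sum (fun i _ => hR0 i) (Finset.mem_univ i)
  -- Small enough that shrinking the active time by `q` costs each rate at most `ε / 4`; the `+ 1`
  -- covers `M = 0`.
  set δ : ℝ := P * ε / (4 * (M + 1)) with hδ
  have hδ0 : 0 < δ := by positivity
  have hδM : M * δ ≤ P * (ε / 4) := by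
    rw [hδ, mul_div_assoc', div_le_iff₀ (by positivity)]
    nlinarith [mul_pos hP hε]
  obtain ⟨N, hN⟩ := (hR δ hδ0).2 (ε / 2) (by positivity)
  set q : ℝ := P / (P + δ) with hq
  have hq0 : 0 < q := by positivity
  have hqM : M * (1 - q) ≤ ε / 4 := by
    have : 1 - q = δ / (P + δ) := by rw [hq]; field_simp; ring
    rw [this, mul_div_assoc', div_le_iff₀ (by positivity)]
    nlinarith [mul_pos hδ0 hε]
  -- `N₁` makes the active length `m` at least `N`; `N₂` keeps the rate lost by rounding `n * q`
  -- down below `ε / 4`.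
  obtain ⟨N₁, hN₁⟩ := exists_nat_ge (((N : ℝ) + 1) / q)
  obtain ⟨N₂, hN₂⟩ := exists_nat_ge (4 * M / ε)
  refine ⟨max (max N₁ N₂) 1, fun n hn => ?_⟩
  have hn1 : N₁ ≤ n := le_trans (le_trans (le_max_left _ _) (le_max_left _ _)) hn
  have hn2 : N₂ ≤ n := le_trans (le_trans (le_max_right _ _) (le_max_left _ _)) hn
  have hn3 : 1 ≤ n := le_trans (le_max_right _ _) hn
  have hnpos : (0 : ℝ) < n := by exact_mod_cast hn3
  set m : ℕ := ⌊(n : ℝ) * q⌋₊ with hm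
  have hmle : (m : ℝ) ≤ n * q := Nat.floor_le (by positivity)
  have hmlt : (n : ℝ) * q < m + 1 := Nat.lt_floor_add_one _
  have hq1 : q ≤ 1 := by rw [hq, div_le_one (by positivity)]; linarith
  have hmn : m ≤ n := by
    have : (m : ℝ) ≤ n := hmle.trans (mul_le_of_le_one_right hnpos.le hq1)
    exact_mod_cast this
  have hNm : N ≤ m := by
    refine Nat.le_floor ?_
    have h1 : ((N : ℝ) + 1) / q ≤ n := hN₁.trans (by exact_mod_cast hn1)
    rw [div_le_iff₀ hq0] at h1
    linarith
  have hMn : M ≤ n * (ε / 4) := by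
    have h1 : 4 * M / ε ≤ n := hN₂.trans (by exact_mod_cast hn2)
    rw [div_le_iff₀ hε] at h1
    linarith
  obtain ⟨c, hc, hc'⟩ := hN m hNm
  have hpow : (m : ℝ) * (P + δ) ≤ n * P := by
    have : q * (P + δ) = P := by rw [hq]; field_simp
    calc (m : ℝ) * (P + δ) ≤ n * q * (P + δ) := by gcongr
      _ = n * P := by rw [mul_assoc, this]
  have hrate : ∀ i, n * (R i - ε) ≤ Real.log (c.size i) := by
    intro i
    have hlog : (m : ℝ) * (R i - ε / 2) ≤ Real.log (c.size i) := by
      -- For `m = 0` the rate is a division by zero and carries no information.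
      rcases Nat.eq_zero_or_pos m with h0 | h0
      · have h0' : (m : ℝ) = 0 := by exact_mod_cast h0
        rw [h0', zero_mul]
        exact Real.log_natCast_nonneg _
      · have := (hc' i).1
        rwa [Code.rate, le_div_iff₀ (by exact_mod_cast h0), mul_comm] at this
    refine le_trans ?_ hlog
    have h1 : R i * (1 - q) ≤ ε / 4 :=
      (mul_le_mul_of_nonneg_right (hRM i) (by linarith)).trans hqM
    have h2 : (n : ℝ) * (R i * (1 - q)) ≤ n * (ε / 4) := by gcongr
    have h3 : R i * (n * q) ≤ R i * (m + 1) :=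
      mul_le_mul_of_nonneg_left hmlt.le (hR0 i)
    have h4 : (m : ℝ) * (ε / 2) ≤ n * (ε / 2) := by gcongr
    -- The loss `ε` splits into `ε / 4` for silence, `ε / 4` for rounding and `ε / 2` from the short
    -- code.
    nlinarith [hRM i]
  obtain ⟨c', hsize, henergy, herror⟩ := c.exists_extension hmn h
  refine ⟨c', henergy.trans_le (hc.trans hpow), fun i => ⟨?_, ?_⟩⟩
  · rw [Code.rate, le_div_iff₀ hnpos, mul_comm, hsize]
    exact hrate i
  · rw [herror]
    linarith [(hc' i).2]

/-- Taking message `i` away from a set `S` of transmitters does not shrink the capacity region when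
no receiver hears message `i` both through `S` and through other transmitters, and receiver `i`
does not hear `S`. -/
theorem capacityRegion_subset_of_freeze {K : ℕ} {h : ℕ → Fin K → Fin K → ℂ}
    {T T' : Fin K → Finset (Fin K)} (i : Fin K) (S : Set (Fin K))
    (hT : ∀ j l, j ∈ T l → j ∈ T' l ∨ l = i ∧ j ∈ S)
    (hS : ∀ r, (∀ t j, h t r j ≠ 0 → j ∉ S) ∨
      r ≠ i ∧ ∀ t j, h t r j ≠ 0 → j ∈ S ∨ j ∉ T i)
    {P : ℝ} (hP : 0 ≤ P) : capacityRegion h T P ⊆ capacityRegion h T' P := by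
  intro R hR
  have hK : (0 : ℝ) < K := by exact_mod_cast i.pos
  have hsum : ∀ {n : ℕ} (c : Code T n) {e : ℝ}, (∀ r, c.errorProb h r ≤ e) →
      ∑ r, c.errorProb h r ≤ K * e := fun c e he =>
    (Finset.sum_le_card_nsmul _ _ e fun r _ => he r).trans_eq (by simp)
  have hsingle : ∀ {n : ℕ} (c : Code T' n) (r : Fin K),
      c.errorProb h r ≤ ∑ r, c.errorProb h r := fun c r =>
    Finset.single_le_sum (f := fun r => c.errorProb h r)
      (fun r _ => c.errorProb_nonneg h r) (Finset.mem_univ r)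
  rcases hP.eq_or_lt with rfl | hP
  · refine ⟨hR.1, fun ε hε => ?_⟩
    obtain ⟨N, hN⟩ := hR.2 (min ε (ε / K)) (by positivity)
    refine ⟨N, fun n hn => ?_⟩
    obtain ⟨c, hc, hc'⟩ := hN n hn
    -- With zero energy on both sides the weighted inequality compares the error sums alone, so
    -- weight `1` suffices.
    obtain ⟨c', hrate, henergy, hsum'⟩ := c.exists_freeze_le i S hT h hS 1
    have hc0 : c.energy = 0 := le_antisymm (by simpa using hc) c.energy_nonneg
    rw [hc0, mul_zero] at henergy
    refine ⟨c', by simpa using henergy, fun r => ⟨?_, ?_⟩⟩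
    · rw [hrate]
      linarith [(hc' r).1, min_le_left ε (ε / K)]
    · have h1 := hsum c fun r => (hc' r).2.trans (min_le_right ε (ε / K))
      rw [mul_div_cancel₀ _ hK.ne'] at h1
      linarith [hsingle c' r, c'.energy_nonneg]
  · refine mem_capacityRegion_of_excess_power hP fun δ hδ => ⟨hR.1, fun ε hε => ?_⟩
    -- Chosen so that the weighted errors of the original code total at most `n * δ`.
    set e : ℝ := δ * ε / ((P + δ) * K) with he
    obtain ⟨N, hN⟩ := hR.2 (min ε e) (by positivity)
    refine ⟨max N 1, fun n hn => ?_⟩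
    have hn0 : (0 : ℝ) < n := by exact_mod_cast (le_max_right N 1).trans hn
    obtain ⟨c, hc, hc'⟩ := hN n ((le_max_left N 1).trans hn)
    -- With this weight, the single budget `n * (P + δ)` bounds the energy and forces the error sum
    -- below `ε`.
    obtain ⟨c', hrate, -, hsum'⟩ := c.exists_freeze_le i S hT h hS (n * (P + δ) / ε)
    have h1 := hsum c fun r => (hc' r).2.trans (min_le_right ε e)
    have ha : 0 < n * (P + δ) / ε := by positivity
    have h2 : n * (P + δ) / ε * (K * e) = n * δ := by
      rw [he]; field_simp
    have h3 : c'.energy + n * (P + δ) / ε * ∑ r, c'.errorProb h r ≤ n * (P + δ) := by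
      have := mul_le_mul_of_nonneg_left h1 ha.le
      linarith
    have h4 : 0 ≤ ∑ r, c'.errorProb h r := Finset.sum_nonneg fun r _ => c'.errorProb_nonneg h r
    refine ⟨c', by linarith [mul_nonneg ha.le h4], fun r => ⟨?_, ?_⟩⟩
    · rw [hrate]
      linarith [(hc' r).1, min_le_left ε e]
    · refine (hsingle c' r).trans (le_of_mul_le_mul_left ?_ ha)
      rw [div_mul_cancel₀ _ hε.ne']
      linarith [c'.energy_nonneg]

/-! ### The component of the removed transmitter -/

theorem mem_of_reachable_messageGraph {K : ℕ} {S : Finset (Fin K)} {k v : Fin K} (hk : k ∈ S)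
    (hv : (messageGraph S).Reachable k v) : v ∈ S := by
  obtain ⟨p⟩ := hv.symm
  cases p with
  | nil => exact hk
  | cons hadj _ => exact hadj.2.1

/-- If a receiver hears `v` in the component of `k` and some `j` knowing message `i`, then `v` and
`j` are equal or adjacent, so `j` is in the component too. Receiver `i` hears only marked vertices,
hence none of the component. -/
theorem capacityRegion_subset_removeTransmitter {K : ℕ} {h : ℕ → Fin K → Fin K → ℂ}
    (hh : IsWynerChannel h) (T : Fin K → Finset (Fin K)) {i k : Fin K} (hk : k ∈ T i)
    (hmark : ∀ v : Fin K, IsMarked i v → ¬ (messageGraph (T i)).Reachable k v)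
    {P : ℝ} (hP : 0 ≤ P) :
    capacityRegion h T P ⊆ capacityRegion h (removeTransmitter T i k) P := by
  refine capacityRegion_subset_of_freeze i {v | (messageGraph (T i)).Reachable k v} ?_ ?_ hP
  · intro j l hj
    by_cases hl : l = i
    · subst hl
      by_cases hjk : j = k
      · subst hjk
        exact Or.inr ⟨rfl, SimpleGraph.Reachable.refl _⟩
      · left
        simp [removeTransmitter, hjk, hj]
    · left
      simpa [removeTransmitter, Function.update_of_ne hl] using hj
  · intro r
    by_cases hr : ∃ v, IsConn r v ∧ (messageGraph (T i)).Reachable k v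
    · obtain ⟨v, hrv, hv⟩ := hr
      refine Or.inr ⟨fun hri => hmark v (hri ▸ hrv) hv, fun t j h0 => ?_⟩
      have hrj := (hh t r j).1 h0
      by_cases hj : j ∈ T i
      · left
        by_cases hvj : v = j
        · exact hvj ▸ hv
        · have hadj : (messageGraph (T i)).Adj v j :=
            ⟨hvj, mem_of_reachable_messageGraph hk hv, hj, r, hrv, hrj⟩
          exact hv.trans hadj.reachable
      · exact Or.inr hj
    · exact Or.inl fun t j h0 hj => hr ⟨j, (hh t r j).1 h0, hj⟩

end WynerIC

open WynerIC in
theorem lemma1 {K : ℕ} (h : ℕ → Fin K → Fin K → ℂ) (hh : IsWynerChannel h)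
    (T : Fin K → Finset (Fin K)) (i k : Fin K) (hk : k ∈ T i)
    (hmark : ∀ v : Fin K, IsMarked i v → ¬ (messageGraph (T i)).Reachable k v)
    (P : ℝ) (hP : 0 ≤ P) :
    (∀ R ∈ capacityRegion h T P, ∃ R' ∈ capacityRegion h (removeTransmitter T i k) P,
      ∑ j, R j ≤ ∑ j, R' j) ∧
    sumCapacity h T P ≤ sumCapacity h (removeTransmitter T i k) P := by
  have hsub := capacityRegion_subset_removeTransmitter hh T hk hmark hP
  exact ⟨fun R hR => ⟨R, hsub hR, le_rfl⟩, biSup_mono fun R hR => hsub hR⟩
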